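/- Let $0<\alpha<1$. Let $\mathbf{Z}_\alpha$ be the standard positive $\alpha$-stable random variable, i.e. the positive random variable with Laplace transform $\mathbb{E}[e^{-\lambda \mathbf{Z}_\alpha}]=e^{-\lambda^\alpha}$ for all $\lambda\ge 0$, let $\mathbf{M}_\alpha\stackrel{d}{=}\mathbf{Z}_\alpha^{-\alpha}$ be the Mittag-Leffler random variable of order $\alpha$, and let $\mathbf{L}$ be an exponential random variable with parameter $1$. For real random variables $X,Y$ write $X\le_{st}Y$ (resp. $X\prec_{cx}Y$) if $\mathbb{E}[\varphi(X)]\le\mathbb{E}[\varphi(Y)]$ for every non-decreasing (resp. convex) function $\varphi:\mathbb{R}\to\mathbb{R}$ for which both expectations exist in $[-\infty,+\infty]$. For positive random variables $X,Y$ write $X\prec_{st}Y$ if $X\le_{st}Y$ and there is no constant $c>1$ such that $cX\le_{st}Y$. Then $$\mathbf{M}_\alpha\;\prec_{st}\;\Gamma(1-\alpha)\,\mathbf{L}\qquad\text{and}\qquad \Gamma(1+\alpha)\,\mathbf{M}_\alpha\;\prec_{cx}\;\mathbf{L}.$$ -/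

import Mathlib

open MeasureTheory ProbabilityTheory

/-- `E[f]` exists in `[-∞, +∞]`: the positive and the negative part of `f` do not both have an
infinite integral. -/
def ExpectationExists {Ω : Type*} [MeasurableSpace Ω] (f : Ω → ℝ) (P : Measure Ω) : Prop :=
  (∫⁻ ω, ENNReal.ofReal (f ω) ∂P) ≠ ⊤ ∨ (∫⁻ ω, ENNReal.ofReal (-f ω) ∂P) ≠ ⊤

/-- The expectation `E[f] = E[f⁺] - E[f⁻]` in `[-∞, +∞]` (meaningful when `ExpectationExists f P`;
it is the Bochner integral when `f` is integrable). -/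
noncomputable def extExpectation {Ω : Type*} [MeasurableSpace Ω] (f : Ω → ℝ) (P : Measure Ω) :
    EReal :=
  ((∫⁻ ω, ENNReal.ofReal (f ω) ∂P : ENNReal) : EReal) -
    ((∫⁻ ω, ENNReal.ofReal (-f ω) ∂P : ENNReal) : EReal)

/-- The stochastic order `X ≤_st Y`: `E[φ(X)] ≤ E[φ(Y)]` for all non-decreasing `φ` for which both
expectations exist. -/
def StochLE {Ω Ω' : Type*} [MeasurableSpace Ω] [MeasurableSpace Ω']
    (X : Ω → ℝ) (P : Measure Ω) (Y : Ω' → ℝ) (P' : Measure Ω') : Prop :=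
  ∀ φ : ℝ → ℝ, Monotone φ →
    ExpectationExists (fun ω => φ (X ω)) P → ExpectationExists (fun ω => φ (Y ω)) P' →
    extExpectation (fun ω => φ (X ω)) P ≤ extExpectation (fun ω => φ (Y ω)) P'

/-- The optimal stochastic order `X ≺_st Y` between positive random variables: `X ≤_st Y`, and
there is no `c > 1` with `c X ≤_st Y`. -/
def OptStochLE {Ω Ω' : Type*} [MeasurableSpace Ω] [MeasurableSpace Ω']
    (X : Ω → ℝ) (P : Measure Ω) (Y : Ω' → ℝ) (P' : Measure Ω') : Prop :=
  StochLE X P Y P' ∧ ¬ ∃ c : ℝ, 1 < c ∧ StochLE (fun ω => c * X ω) P Y P'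

/-- The convex order `X ≺_cx Y`: `E[φ(X)] ≤ E[φ(Y)]` for all convex `φ` for which both
expectations exist. -/
def ConvexLE {Ω Ω' : Type*} [MeasurableSpace Ω] [MeasurableSpace Ω']
    (X : Ω → ℝ) (P : Measure Ω) (Y : Ω' → ℝ) (P' : Measure Ω') : Prop :=
  ∀ φ : ℝ → ℝ, ConvexOn ℝ Set.univ φ →
    ExpectationExists (fun ω => φ (X ω)) P → ExpectationExists (fun ω => φ (Y ω)) P' →
    extExpectation (fun ω => φ (X ω)) P ≤ extExpectation (fun ω => φ (Y ω)) P'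

/-- `Z` is a standard positive `α`-stable random variable: an almost surely positive random
variable with Laplace transform `E[exp (-t Z)] = exp (-t ^ α)`, `t ≥ 0`. -/
structure IsPositiveStable {Ω : Type*} [MeasurableSpace Ω] (α : ℝ) (Z : Ω → ℝ) (P : Measure Ω) :
    Prop where
  aemeasurable : AEMeasurable Z P
  pos : ∀ᵐ ω ∂P, 0 < Z ω
  laplace : ∀ t : ℝ, 0 ≤ t → ∫ ω, Real.exp (-(t * Z ω)) ∂P = Real.exp (-(t ^ α))

/-- `M` is a Mittag-Leffler random variable of order `α`: it has the law of `Z ^ (-α)` for the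
standard positive `α`-stable random variable `Z` (`ν` is the law of `Z`). -/
def IsMittagLeffler {Ω : Type*} [MeasurableSpace Ω] (α : ℝ) (M : Ω → ℝ) (P : Measure Ω) : Prop :=
  ∃ ν : Measure ℝ, IsProbabilityMeasure ν ∧ IsPositiveStable α (fun z : ℝ => z) ν ∧
    IdentDistrib M (fun z : ℝ => z ^ (-α)) P ν

/-! Write S for the survival function of M and F = 1 - S. Since M > x means x^(1/α) Z < 1, and
s^(1/α) Z₁ + t^(1/α) Z₂ has the law of (s+t)^(1/α) Z for independent copies Z₁, Z₂, positivity gives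
S(s+t) ≤ S(s) S(t): M is new better than used (`IsPositiveStable.mittagLefflerLaw_Ioi_add_le`). Both
claims follow from this.

Convex order: after scaling to mean one, H(x) = ∫_x^∞ S satisfies H ≤ S = -H' and H(0) = 1, so H(x)
≤ e^(-x), the integrated tail of L (`lintegral_measure_Ioi_le_exp`). With equal means, this ordering
suffices (`extExpectation_le_of_convexOn`).

Stochastic order: the slope of F at 0 should be 1/Γ(1-α). The Laplace transform says that F(s
u^(-α)), averaged over an exponential u, equals 1 - e^(-s); letting s → 0 pins down the slope in any
bound of F by a y + b y^p. If S(x) > e^(-θx) with θ < 1/Γ(1-α), submultiplicativity makes F too flat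
at 0. Conversely c M ≤_st Γ(1-α) L with c > 1 makes F too steep. -/

/-! ### Stochastic order and survival functions -/

section Orders

open Set Filter Topology

lemma extExpectation_comp_eq_map {Ω : Type*} [MeasurableSpace Ω] {P : Measure Ω} {X : Ω → ℝ}
    (hX : AEMeasurable X P) {φ : ℝ → ℝ} (hφ : Measurable φ) :
    extExpectation (fun ω => φ (X ω)) P = extExpectation φ (P.map X) := by
  unfold extExpectation
  have hφ' : Measurable fun x => -φ x := hφ.neg
  rw [lintegral_map' hφ.ennreal_ofReal.aemeasurable hX,
    lintegral_map' hφ'.ennreal_ofReal.aemeasurable hX]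

/-- If `μ` gives less mass than `ν` to every open upper ray, then also to every upper set. -/
lemma measure_upperSet_le {μ ν : Measure ℝ} [IsFiniteMeasure μ] [IsFiniteMeasure ν]
    (h : ∀ a, μ (Ioi a) ≤ ν (Ioi a)) {U : Set ℝ} (hU : IsUpperSet U) : μ U ≤ ν U := by
  have hanti : ∀ (ρ : Measure ℝ) [IsFiniteMeasure ρ] (a : ℝ),
      Tendsto (fun n : ℕ => ρ (Ioi (a - 1 / ((n : ℝ) + 1)))) atTop (𝓝 (ρ (Ici a))) := by
    intro ρ _ a
    have hI : Ici a = ⋂ n : ℕ, Ioi (a - 1 / ((n : ℝ) + 1)) := by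
      ext x
      simp only [mem_Ici, mem_iInter, mem_Ioi]
      constructor
      · intro hx n
        have : (0 : ℝ) < 1 / ((n : ℝ) + 1) := by positivity
        linarith
      · intro hx
        refine le_of_forall_pos_lt_add fun ε hε => ?_
        obtain ⟨n, hn⟩ := exists_nat_one_div_lt hε
        have := hx n
        linarith
    rw [hI]
    refine tendsto_measure_iInter_atTop (fun n => measurableSet_Ioi.nullMeasurableSet) ?_
      ⟨0, measure_ne_top _ _⟩
    intro n k hnk
    refine Ioi_subset_Ioi ?_
    have := Nat.one_div_le_one_div (α := ℝ) hnk
    linarith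
  -- An upper set of the line is empty, a closed or open ray, or everything; the last three are
  -- limits of open rays or open rays themselves.
  rcases U.eq_empty_or_nonempty with rfl | hne
  · simp
  by_cases hb : BddBelow U
  · have hsub : Ioi (sInf U) ⊆ U := fun x hx => by
      obtain ⟨y, hy, hyx⟩ := exists_lt_of_csInf_lt hne hx
      exact hU hyx.le hy
    by_cases hmem : sInf U ∈ U
    · have : U = Ici (sInf U) :=
        Subset.antisymm (fun x hx => csInf_le hb hx) (fun x hx => hU hx hmem)
      rw [this]
      exact le_of_tendsto_of_tendsto' (hanti μ _) (hanti ν _) fun n => h _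
    · have : U = Ioi (sInf U) := Subset.antisymm
        (fun x hx => lt_of_le_of_ne (csInf_le hb hx) fun e => hmem (e ▸ hx)) hsub
      rw [this]
      exact h _
  · have hUu : U = univ := by
      refine eq_univ_of_forall fun x => ?_
      obtain ⟨y, hy, hyx⟩ := not_bddBelow_iff.1 hb x
      exact hU hyx.le hy
    have hlim : ∀ ρ : Measure ℝ, Tendsto (fun n : ℕ => ρ (Ioi (-(n : ℝ)))) atTop (𝓝 (ρ univ)) := by
      intro ρ
      have : (univ : Set ℝ) = ⋃ n : ℕ, Ioi (-(n : ℝ)) := by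
        refine (eq_univ_of_forall fun x => ?_).symm
        obtain ⟨n, hn⟩ := exists_nat_gt (-x)
        exact mem_iUnion.2 ⟨n, by simp only [mem_Ioi]; linarith⟩
      rw [this]
      refine tendsto_measure_iUnion_atTop fun n k hnk => Ioi_subset_Ioi ?_
      have : (n : ℝ) ≤ k := by exact_mod_cast hnk
      linarith
    rw [hUu]
    exact le_of_tendsto_of_tendsto' (hlim μ) (hlim ν) fun n => h _

/-- Layer cake: the integral of the positive part sees only the superlevel sets. -/
lemma lintegral_ofReal_le_of_meas_le {μ ν : Measure ℝ} {g : ℝ → ℝ} (hg : Measurable g)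
    (h : ∀ t, μ {x | t < g x} ≤ ν {x | t < g x}) :
    ∫⁻ x, ENNReal.ofReal (g x) ∂μ ≤ ∫⁻ x, ENNReal.ofReal (g x) ∂ν := by
  have key : ∀ ρ : Measure ℝ, ∫⁻ x, ENNReal.ofReal (g x) ∂ρ
      = ∫⁻ t in Ioi (0 : ℝ), ρ {x | t < g x} := by
    intro ρ
    have h1 : ∀ x, ENNReal.ofReal (g x) = ENNReal.ofReal (max (g x) 0) := fun x => by
      rcases le_total (g x) 0 with h | h
      · simp [max_eq_right h, ENNReal.ofReal_of_nonpos h]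
      · rw [max_eq_left h]
    simp_rw [h1]
    rw [lintegral_eq_lintegral_meas_lt (f := fun x => max (g x) 0) ρ
      (ae_of_all _ fun x => le_max_right _ _)
      (hg.max measurable_const).aemeasurable]
    refine setLIntegral_congr_fun measurableSet_Ioi fun t ht => ?_
    have ht' : ¬ t < 0 := not_lt.2 (le_of_lt ht)
    simp [ht']
  rw [key, key]
  exact lintegral_mono fun t => h t

lemma lintegral_ofReal_le_of_monotone {μ ν : Measure ℝ} [IsFiniteMeasure μ] [IsFiniteMeasure ν]
    (h : ∀ a, μ (Ioi a) ≤ ν (Ioi a)) {g : ℝ → ℝ} (hg : Monotone g) :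
    ∫⁻ x, ENNReal.ofReal (g x) ∂μ ≤ ∫⁻ x, ENNReal.ofReal (g x) ∂ν :=
  lintegral_ofReal_le_of_meas_le hg.measurable fun _ =>
    measure_upperSet_le h fun _ _ hxy hx => lt_of_lt_of_le hx (hg hxy)

/-- The superlevel sets of -φ are complements of upper sets, so equal total masses reverse the
comparison for the negative part. -/
lemma extExpectation_le_of_monotone {μ ν : Measure ℝ} [IsProbabilityMeasure μ]
    [IsProbabilityMeasure ν] (h : ∀ a, μ (Ioi a) ≤ ν (Ioi a)) {φ : ℝ → ℝ} (hφ : Monotone φ) :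
    extExpectation φ μ ≤ extExpectation φ ν := by
  refine EReal.sub_le_sub (EReal.coe_ennreal_le_coe_ennreal_iff.2
    (lintegral_ofReal_le_of_monotone h hφ)) (EReal.coe_ennreal_le_coe_ennreal_iff.2
    (lintegral_ofReal_le_of_meas_le hφ.measurable.neg fun t => ?_))
  have hc : {x | t < -φ x} = {x | -t ≤ φ x}ᶜ := by
    ext x
    simp only [mem_ofPred_eq, mem_compl_iff, not_le]
    constructor <;> intro h <;> linarith
  have hm : MeasurableSet {x | -t ≤ φ x} := measurableSet_le measurable_const hφ.measurable
  rw [hc, prob_compl_eq_one_sub hm, prob_compl_eq_one_sub hm]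
  exact tsub_le_tsub_left (measure_upperSet_le h fun _ _ hxy hx => le_trans hx (hφ hxy)) _

/-- Comparison of the survival functions gives the stochastic order. -/
lemma stochLE_of_map_Ioi_le {Ω Ω' : Type*} [MeasurableSpace Ω] [MeasurableSpace Ω']
    {P : Measure Ω} [IsProbabilityMeasure P] {P' : Measure Ω'} [IsProbabilityMeasure P']
    {X : Ω → ℝ} {Y : Ω' → ℝ} (hX : AEMeasurable X P) (hY : AEMeasurable Y P')
    (h : ∀ a, P.map X (Ioi a) ≤ P'.map Y (Ioi a)) : StochLE X P Y P' := by
  intro φ hφ _ _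
  have := Measure.isProbabilityMeasure_map hX
  have := Measure.isProbabilityMeasure_map hY
  rw [extExpectation_comp_eq_map hX hφ.measurable, extExpectation_comp_eq_map hY hφ.measurable]
  exact extExpectation_le_of_monotone h hφ

/-- The stochastic order gives the comparison of the survival functions. -/
lemma StochLE.map_Ioi_le {Ω Ω' : Type*} [MeasurableSpace Ω] [MeasurableSpace Ω']
    {P : Measure Ω} [IsProbabilityMeasure P] {P' : Measure Ω'} [IsProbabilityMeasure P']
    {X : Ω → ℝ} {Y : Ω' → ℝ} (hX : AEMeasurable X P) (hY : AEMeasurable Y P')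
    (h : StochLE X P Y P') (a : ℝ) : P.map X (Ioi a) ≤ P'.map Y (Ioi a) := by
  have := Measure.isProbabilityMeasure_map hX
  have := Measure.isProbabilityMeasure_map hY
  set φ : ℝ → ℝ := (Ioi a).indicator 1 with hφdef
  have hφm : Measurable φ := measurable_one.indicator measurableSet_Ioi
  have h0 : ∀ x, 0 ≤ φ x := fun x => indicator_nonneg (fun _ _ => zero_le_one) x
  have hφ : Monotone φ := by
    intro x y hxy
    by_cases hx : a < x
    · have hy : a < y := lt_of_lt_of_le hx hxy
      simp [hφdef, hx, hy]
    · have : φ x = 0 := by simp [hφdef, hx]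
      rw [this]
      exact h0 y
  have hneg : ∀ x, ENNReal.ofReal (-φ x) = 0 := fun x =>
    ENNReal.ofReal_of_nonpos (by linarith [h0 x])
  have hext : ∀ ρ : Measure ℝ, extExpectation φ ρ = (ρ (Ioi a) : EReal) := by
    intro ρ
    have hpos : ∀ x, ENNReal.ofReal (φ x) = (Ioi a).indicator 1 x := fun x => by
      by_cases hx : a < x <;> simp [hφdef, hx]
    unfold extExpectation
    simp_rw [hneg, hpos]
    rw [lintegral_indicator_one measurableSet_Ioi]
    simp
  have := h φ hφ (Or.inr (by simp [hneg])) (Or.inr (by simp [hneg]))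
  rw [extExpectation_comp_eq_map hX hφm, extExpectation_comp_eq_map hY hφm, hext, hext] at this
  exact EReal.coe_ennreal_le_coe_ennreal_iff.1 this

end Orders

/-! ### Convex order and comparison with the exponential law -/

section ConvexOrder

open Set Filter Topology

/-- A convex function is the integral of its monotone right derivative. Removing the slope c at 0
leaves a remainder that is nonnegative on the half-line, while the affine part sees only the mean.
-/
lemma ConvexOn.exists_monotone_integral {φ : ℝ → ℝ} (hφ : ConvexOn ℝ univ φ) :
    ∃ (c : ℝ) (g : ℝ → ℝ), Monotone g ∧ (∀ t, 0 ≤ t → 0 ≤ g t) ∧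
      ∀ x, 0 ≤ x → φ x = φ 0 + c * x + ∫ t in (0 : ℝ)..x, g t := by
  set d : ℝ → ℝ := fun t => derivWithin φ (Ioi t) t with hd
  have hmono : Monotone d := by
    intro x y hxy
    exact hφ.monotoneOn_rightDeriv (by simp) (by simp) hxy
  refine ⟨d 0, fun t => d t - d 0, fun x y hxy => sub_le_sub_right (hmono hxy) _,
    fun t ht => sub_nonneg.2 (hmono ht), fun x hx => ?_⟩
  have hint : IntervalIntegrable d volume 0 x := hmono.intervalIntegrable
  have hcont : Continuous φ := continuousOn_univ.1 (hφ.continuousOn isOpen_univ)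
  have hftc : ∫ t in (0 : ℝ)..x, d t = φ x - φ 0 :=
    intervalIntegral.integral_eq_sub_of_hasDeriv_right_of_le hx hcont.continuousOn
      (fun t _ => hφ.hasDerivWithinAt_rightDeriv_of_mem_interior (by simp)) hint
  rw [intervalIntegral.integral_sub hint (by simp), hftc]
  simp
  ring

lemma extExpectation_of_integrable {μ : Measure ℝ} {f : ℝ → ℝ} (hf : Integrable f μ) :
    extExpectation f μ = ((∫ x, f x ∂μ : ℝ) : EReal) := by
  have h1 : ∫⁻ x, ENNReal.ofReal (f x) ∂μ ≠ ⊤ := hf.lintegral_lt_top.ne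
  have h2 : ∫⁻ x, ENNReal.ofReal (-f x) ∂μ ≠ ⊤ := hf.neg.lintegral_lt_top.ne
  rw [extExpectation, integral_eq_lintegral_pos_part_sub_lintegral_neg_part hf, EReal.coe_sub,
    EReal.coe_ennreal_toReal h1, EReal.coe_ennreal_toReal h2]

/-- The affine part is integrable and ψ ≥ 0, so the negative part of f is integrable and no ⊤ - ⊤
arises even if ψ has infinite integral. -/
lemma extExpectation_affine_add {μ : Measure ℝ} [IsProbabilityMeasure μ] {f ψ : ℝ → ℝ}
    {a c : ℝ} (hid : Integrable (fun x => x) μ) (hψ : AEMeasurable ψ μ)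
    (hψ0 : ∀ᵐ x ∂μ, 0 ≤ ψ x) (hf : ∀ᵐ x ∂μ, f x = a + c * x + ψ x) :
    extExpectation f μ = ((a + c * ∫ x, x ∂μ : ℝ) : EReal)
      + ((∫⁻ x, ENNReal.ofReal (ψ x) ∂μ : ENNReal) : EReal) := by
  have hlin : Integrable (fun x => a + c * x) μ := (integrable_const a).add (hid.const_mul c)
  by_cases htop : ∫⁻ x, ENNReal.ofReal (ψ x) ∂μ = ⊤
  · have hneg : ∫⁻ x, ENNReal.ofReal (-f x) ∂μ ≠ ⊤ := by
      refine ne_top_of_le_ne_top hlin.neg.lintegral_lt_top.ne (lintegral_mono_ae ?_)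
      filter_upwards [hψ0, hf] with x h0 hx
      refine ENNReal.ofReal_le_ofReal ?_
      simp only [Pi.neg_apply]
      linarith
    have hpos : ∫⁻ x, ENNReal.ofReal (f x) ∂μ = ⊤ := by
      by_contra hne
      refine (ENNReal.add_ne_top.2 ⟨hne, hlin.neg.lintegral_lt_top.ne⟩) ?_
      rw [eq_top_iff, ← htop]
      refine le_trans (lintegral_mono_ae ?_)
        (le_of_eq (lintegral_add_right' _ hlin.neg.aemeasurable.ennreal_ofReal))
      filter_upwards [hf] with x hx
      refine le_trans (ENNReal.ofReal_le_ofReal ?_) ENNReal.ofReal_add_le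
      simp only [Pi.neg_apply]
      linarith
    rw [extExpectation, hpos, htop]
    lift (∫⁻ x, ENNReal.ofReal (-f x) ∂μ) to NNReal using hneg with b
    rw [EReal.coe_ennreal_top, EReal.coe_add_top]
    exact EReal.top_sub_coe b
  · have hψi : Integrable ψ μ := by
      refine ⟨hψ.aestronglyMeasurable, ?_⟩
      rw [hasFiniteIntegral_iff_ofReal hψ0]
      exact lt_top_iff_ne_top.2 htop
    have hfi : Integrable f μ := (hlin.add hψi).congr (hf.mono fun x hx => by simp [hx])
    have hval : ∫ x, f x ∂μ = a + c * ∫ x, x ∂μ + ∫ x, ψ x ∂μ := by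
      rw [integral_congr_ae hf, integral_add hlin hψi, integral_add (integrable_const a)
        (hid.const_mul c), integral_const_mul]
      simp
    rw [extExpectation_of_integrable hfi, hval, EReal.coe_add]
    congr 1
    rw [integral_eq_lintegral_of_nonneg_ae hψ0 hψ.aestronglyMeasurable,
      EReal.coe_ennreal_toReal htop]

lemma measurable_measure_Ioi (μ : Measure ℝ) : Measurable fun t => μ (Ioi t) :=
  Antitone.measurable fun _ _ h => measure_mono (Ioi_subset_Ioi h)

lemma lintegral_measure_Ioi {μ : Measure ℝ} (h0 : ∀ᵐ x ∂μ, 0 ≤ x) :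
    ∫⁻ t in Ioi (0 : ℝ), μ (Ioi t) = ∫⁻ x, ENNReal.ofReal x ∂μ :=
  (lintegral_eq_lintegral_meas_lt μ h0 aemeasurable_id).symm

/-- Two laws on the half-line with the same mean are in the convex order as soon as their
integrated survival functions are ordered. -/
lemma extExpectation_le_of_convexOn {μ ν : Measure ℝ} [IsProbabilityMeasure μ]
    [IsProbabilityMeasure ν] (hμ0 : ∀ᵐ x ∂μ, 0 ≤ x) (hν0 : ∀ᵐ x ∂ν, 0 ≤ x)
    (hμ1 : ∫⁻ x, ENNReal.ofReal x ∂μ = 1) (hν1 : ∫⁻ x, ENNReal.ofReal x ∂ν = 1)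
    (h : ∀ a, 0 ≤ a → ∫⁻ t in Ioi a, μ (Ioi t) ≤ ∫⁻ t in Ioi a, ν (Ioi t))
    {φ : ℝ → ℝ} (hφ : ConvexOn ℝ univ φ) : extExpectation φ μ ≤ extExpectation φ ν := by
  obtain ⟨c, g, hg, hg0, hrep⟩ := hφ.exists_monotone_integral
  have hψmeas : Measurable fun x => ∫ t in (0 : ℝ)..x, g t :=
    (intervalIntegral.continuous_primitive (fun a b => hg.intervalIntegrable) 0).measurable
  -- By layer cake, the remainder integrates to ∫ g(t) ρ(t,∞) dt over t > 0. The tail thus becomes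
  -- the density of a finite measure, of mass the mean, and as g is monotone only a comparison of
  -- rays for these measures is left.
  have key : ∀ (ρ : Measure ℝ) [IsProbabilityMeasure ρ], (∀ᵐ x ∂ρ, 0 ≤ x) →
      ∫⁻ x, ENNReal.ofReal x ∂ρ = 1 → extExpectation φ ρ = ((φ 0 + c * 1 : ℝ) : EReal)
        + ((∫⁻ x, ENNReal.ofReal (g x) ∂((volume.restrict (Ioi 0)).withDensity
            fun t => ρ (Ioi t)) : ENNReal) : EReal) := by
    intro ρ _ hρ0 hρ1
    have hid : Integrable (fun x : ℝ => x) ρ :=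
      ⟨aestronglyMeasurable_id, by rw [hasFiniteIntegral_iff_ofReal hρ0, hρ1]; simp⟩
    have hmean : ∫ x, x ∂ρ = 1 := by
      rw [integral_eq_lintegral_of_nonneg_ae hρ0 aestronglyMeasurable_id, hρ1, ENNReal.toReal_one]
    rw [extExpectation_affine_add hid hψmeas.aemeasurable
      (hρ0.mono fun x hx => intervalIntegral.integral_nonneg hx fun t ht => hg0 t ht.1)
      (hρ0.mono fun x hx => hrep x hx), hmean]
    congr 2
    rw [lintegral_comp_eq_lintegral_meas_lt_mul (f := fun x => x) ρ hρ0 aemeasurable_id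
      (fun t _ => hg.intervalIntegrable)
      ((ae_restrict_iff' measurableSet_Ioi).2 (ae_of_all _ fun t ht => hg0 t (le_of_lt ht))),
      lintegral_withDensity_eq_lintegral_mul _ (measurable_measure_Ioi ρ)
        hg.measurable.ennreal_ofReal]
    rfl
  rw [key μ hμ0 hμ1, key ν hν0 hν1]
  have hfin : ∀ (ρ : Measure ℝ), (∀ᵐ x ∂ρ, 0 ≤ x) → ∫⁻ x, ENNReal.ofReal x ∂ρ = 1 →
      IsFiniteMeasure ((volume.restrict (Ioi 0)).withDensity fun t => ρ (Ioi t)) :=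
    fun ρ hρ0 hρ1 => isFiniteMeasure_withDensity (by
      rw [lintegral_measure_Ioi hρ0, hρ1]; exact ENNReal.one_ne_top)
  have := hfin μ hμ0 hμ1
  have := hfin ν hν0 hν1
  refine add_le_add le_rfl (EReal.coe_ennreal_le_coe_ennreal_iff.2
    (lintegral_ofReal_le_of_monotone (fun a => ?_) hg))
  have hray : ∀ ρ : Measure ℝ, (volume.restrict (Ioi 0)).withDensity (fun t => ρ (Ioi t)) (Ioi a)
      = ∫⁻ t in Ioi (max a 0), ρ (Ioi t) := fun ρ => by
    rw [withDensity_apply _ measurableSet_Ioi, Measure.restrict_restrict measurableSet_Ioi,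
      Ioi_inter_Ioi]
  rw [hray, hray]
  exact h _ (le_max_right _ _)

/-- If `μ` is new better than used with mean one, its integrated survival function is dominated
by that of the standard exponential law. -/
lemma lintegral_measure_Ioi_le_exp {μ : Measure ℝ} [IsProbabilityMeasure μ]
    (h1 : ∫⁻ t in Ioi (0 : ℝ), μ (Ioi t) = 1)
    (hnbu : ∀ s t, 0 ≤ s → 0 ≤ t → μ (Ioi (s + t)) ≤ μ (Ioi s) * μ (Ioi t)) {a : ℝ} (ha : 0 ≤ a) :
    ∫⁻ t in Ioi a, μ (Ioi t) ≤ ENNReal.ofReal (Real.exp (-a)) := by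
  have hle : ∀ x, 0 ≤ x → ∫⁻ t in Ioi x, μ (Ioi t) ≤ μ (Ioi x) := by
    intro x hx
    have hshift : ∫⁻ t in Ioi x, μ (Ioi t) = ∫⁻ t in Ioi (0 : ℝ), μ (Ioi (x + t)) := by
      rw [← lintegral_indicator measurableSet_Ioi, ← lintegral_indicator measurableSet_Ioi,
        ← lintegral_add_left_eq_self _ x]
      congr 1 with t
      simp [indicator]
    calc _ = ∫⁻ t in Ioi (0 : ℝ), μ (Ioi (x + t)) := hshift
      _ ≤ ∫⁻ t in Ioi (0 : ℝ), μ (Ioi x) * μ (Ioi t) :=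
        setLIntegral_mono ((measurable_measure_Ioi μ).const_mul _) fun t ht =>
          hnbu x t hx (le_of_lt ht)
      _ = μ (Ioi x) := by rw [lintegral_const_mul _ (measurable_measure_Ioi μ), h1, mul_one]
  set H : ℝ → ENNReal := fun x => ∫⁻ t in Ioi x, μ (Ioi t) with hH
  -- Discrete form of H ≤ -H', avoiding derivatives. Iterated with δ = a/n it gives (1 + a/n)^n H(a)
  -- ≤ H(0) = 1, and n → ∞ yields the exponential.
  have hstep : ∀ x δ, 0 ≤ x → 0 ≤ δ → ENNReal.ofReal (1 + δ) * H (x + δ) ≤ H x := by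
    intro x δ hx hδ
    have hsplit : H x = (∫⁻ t in Ioc x (x + δ), μ (Ioi t)) + H (x + δ) := by
      simp only [hH]
      rw [← lintegral_union measurableSet_Ioi
        (disjoint_left.2 fun t ht ht' => not_lt.2 ht.2 ht'), Ioc_union_Ioi_eq_Ioi (by linarith)]
    have hlow : ENNReal.ofReal δ * H (x + δ) ≤ ∫⁻ t in Ioc x (x + δ), μ (Ioi t) := by
      calc ENNReal.ofReal δ * H (x + δ) ≤ ENNReal.ofReal δ * μ (Ioi (x + δ)) := by
            gcongr; exact hle _ (by linarith)
        _ = ∫⁻ t in Ioc x (x + δ), μ (Ioi (x + δ)) := by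
            rw [setLIntegral_const, Real.volume_Ioc, mul_comm]; simp
        _ ≤ _ := setLIntegral_mono (measurable_measure_Ioi μ) fun t ht =>
            measure_mono (Ioi_subset_Ioi ht.2)
    rw [ENNReal.ofReal_add zero_le_one hδ, add_mul, ENNReal.ofReal_one, one_mul, hsplit, add_comm]
    gcongr
  have hpow : ∀ (δ : ℝ), 0 ≤ δ → ∀ n : ℕ, ENNReal.ofReal ((1 + δ) ^ n) * H (n * δ) ≤ 1 := by
    intro δ hδ n
    induction n with
    | zero => simp [hH, h1]
    | succ k ih =>
      refine le_trans ?_ ih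
      rw [pow_succ, ENNReal.ofReal_mul (by positivity), mul_assoc]
      gcongr
      have := hstep (k * δ) δ (by positivity) hδ
      push_cast
      rwa [add_mul, one_mul]
  have hlim : Tendsto (fun n : ℕ => ENNReal.ofReal ((1 + a / n) ^ n) * H a) atTop
      (𝓝 (ENNReal.ofReal (Real.exp a) * H a)) := by
    refine ENNReal.Tendsto.mul_const ?_ (Or.inl (ENNReal.ofReal_pos.2 (Real.exp_pos a)).ne')
    exact ENNReal.tendsto_ofReal (Real.tendsto_one_add_div_pow_exp a)
  have hfinal : ENNReal.ofReal (Real.exp a) * H a ≤ 1 := by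
    refine le_of_tendsto hlim ?_
    filter_upwards [eventually_gt_atTop 0] with n hn
    have hn' : (n : ℝ) ≠ 0 := by positivity
    have := hpow (a / n) (by positivity) n
    rwa [mul_div_cancel₀ _ hn'] at this
  calc H a = ENNReal.ofReal (Real.exp (-a)) * (ENNReal.ofReal (Real.exp a) * H a) := by
        rw [← mul_assoc, ← ENNReal.ofReal_mul (Real.exp_pos _).le, ← Real.exp_add]; simp
    _ ≤ ENNReal.ofReal (Real.exp (-a)) * 1 := by gcongr
    _ = _ := mul_one _

lemma expMeasure_Ioi {a : ℝ} (ha : 0 ≤ a) :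
    expMeasure 1 (Ioi a) = ENNReal.ofReal (Real.exp (-a)) := by
  have := isProbabilityMeasure_expMeasure (r := 1) one_pos
  have h := cdf_expMeasure_eq (r := 1) one_pos a
  rw [cdf_eq_real, if_pos ha, one_mul] at h
  rw [← compl_Iic, prob_compl_eq_one_sub measurableSet_Iic, ← ofReal_measureReal, h,
    ← ENNReal.ofReal_one, ← ENNReal.ofReal_sub _ (by simp [ha])]
  simp

lemma ae_nonneg_expMeasure : ∀ᵐ x ∂expMeasure 1, 0 ≤ x := by
  have := isProbabilityMeasure_expMeasure (r := 1) one_pos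
  have : ∀ᵐ x ∂expMeasure 1, x ∈ Ioi (0 : ℝ) := by
    change Ioi (0 : ℝ) ∈ ae _
    rw [mem_ae_iff_prob_eq_one measurableSet_Ioi]
    simp [expMeasure_Ioi le_rfl]
  exact this.mono fun x hx => le_of_lt hx

lemma lintegral_expMeasure_Ioi {a : ℝ} (ha : 0 ≤ a) :
    ∫⁻ t in Ioi a, expMeasure 1 (Ioi t) = ENNReal.ofReal (Real.exp (-a)) := by
  rw [setLIntegral_congr_fun measurableSet_Ioi
      fun t (ht : a < t) => expMeasure_Ioi (ha.trans ht.le),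
    ← ofReal_integral_eq_lintegral_ofReal (integrableOn_exp_neg_Ioi a)
      (ae_of_all _ fun t => (Real.exp_pos _).le), integral_exp_neg_Ioi]

/-- A positive law that is new better than used and has mean one is smaller than the standard
exponential law in the convex order. -/
lemma convexLE_exp_of_newBetterThanUsed {Ω Ω' : Type*} [MeasurableSpace Ω] [MeasurableSpace Ω']
    {P : Measure Ω} [IsProbabilityMeasure P] {P' : Measure Ω'}
    {X : Ω → ℝ} {L : Ω' → ℝ} (hX : AEMeasurable X P) (hL : HasLaw L (expMeasure 1) P')
    (hX0 : ∀ᵐ x ∂P.map X, 0 ≤ x) (hX1 : ∫⁻ x, ENNReal.ofReal x ∂P.map X = 1)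
    (hnbu : ∀ s t, 0 ≤ s → 0 ≤ t →
      P.map X (Ioi (s + t)) ≤ P.map X (Ioi s) * P.map X (Ioi t)) : ConvexLE X P L P' := by
  intro φ hφ _ _
  have hcont : Continuous φ := continuousOn_univ.1 (hφ.continuousOn isOpen_univ)
  have := Measure.isProbabilityMeasure_map hX
  have := isProbabilityMeasure_expMeasure (r := 1) one_pos
  rw [extExpectation_comp_eq_map hX hcont.measurable,
    extExpectation_comp_eq_map hL.aemeasurable hcont.measurable, hL.map_eq]
  refine extExpectation_le_of_convexOn hX0 ae_nonneg_expMeasure hX1 ?_ (fun a ha => ?_) hφ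
  · rw [← lintegral_measure_Ioi ae_nonneg_expMeasure, lintegral_expMeasure_Ioi le_rfl]
    simp
  · rw [lintegral_expMeasure_Ioi ha]
    exact lintegral_measure_Ioi_le_exp (by rw [lintegral_measure_Ioi hX0, hX1]) hnbu ha

end ConvexOrder

/-! ### Uniqueness of the Laplace transform -/

section LaplaceUniqueness

open Set Filter Topology

/-- Weierstrass approximation on [0, 1]. -/
lemma Measure.ext_of_integral_pow_eq {ρ σ : Measure ℝ} [IsProbabilityMeasure ρ]
    [IsProbabilityMeasure σ] (hρ : ∀ᵐ x ∂ρ, x ∈ Icc (0 : ℝ) 1) (hσ : ∀ᵐ x ∂σ, x ∈ Icc (0 : ℝ) 1)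
    (h : ∀ n : ℕ, ∫ x, x ^ n ∂ρ = ∫ x, x ^ n ∂σ) : ρ = σ := by
  have hint : ∀ (τ : Measure ℝ) [IsProbabilityMeasure τ], (∀ᵐ x ∂τ, x ∈ Icc (0 : ℝ) 1) →
      ∀ f : ℝ → ℝ, Continuous f → Integrable f τ := by
    intro τ _ hτ f hf
    obtain ⟨C, hC⟩ := isCompact_Icc.exists_bound_of_continuousOn (s := Icc (0 : ℝ) 1)
      hf.continuousOn
    exact Integrable.of_bound hf.aestronglyMeasurable C (hτ.mono fun x hx => hC x hx)
  have hpoly : ∀ p : Polynomial ℝ, ∫ x, p.eval x ∂ρ = ∫ x, p.eval x ∂σ := by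
    intro p
    simp_rw [Polynomial.eval_eq_sum_range]
    rw [integral_finsetSum _ fun i _ => hint ρ hρ _ (by fun_prop),
      integral_finsetSum _ fun i _ => hint σ hσ _ (by fun_prop)]
    simp_rw [integral_const_mul, h]
  refine ext_of_forall_integral_eq_of_IsFiniteMeasure fun f => ?_
  refine eq_of_forall_dist_le fun ε hε => ?_
  obtain ⟨p, hp⟩ := exists_polynomial_near_of_continuousOn 0 1 f f.continuous.continuousOn (ε / 2)
    (half_pos hε)
  have happ : ∀ (τ : Measure ℝ) [IsProbabilityMeasure τ], (∀ᵐ x ∂τ, x ∈ Icc (0 : ℝ) 1) →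
      |∫ x, p.eval x ∂τ - ∫ x, f x ∂τ| ≤ ε / 2 := by
    intro τ _ hτ
    rw [← integral_sub (hint τ hτ _ p.continuous) (hint τ hτ _ f.continuous), ← Real.norm_eq_abs]
    refine (norm_integral_le_of_norm_le_const (hτ.mono fun x hx => (hp x hx).le)).trans ?_
    simp
  have h1 := abs_le.1 (happ ρ hρ)
  have h2 := abs_le.1 (happ σ hσ)
  rw [hpoly] at h1
  rw [Real.dist_eq, abs_le]
  constructor <;> linarith [h1.1, h1.2, h2.1, h2.2]

/-- A probability measure on the half-line is determined by its Laplace transform. -/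
lemma Measure.ext_of_integral_exp_neg_eq {μ ν : Measure ℝ} [IsProbabilityMeasure μ]
    [IsProbabilityMeasure ν] (hμ : ∀ᵐ x ∂μ, 0 ≤ x) (hν : ∀ᵐ x ∂ν, 0 ≤ x)
    (h : ∀ t : ℝ, 0 ≤ t → ∫ x, Real.exp (-(t * x)) ∂μ = ∫ x, Real.exp (-(t * x)) ∂ν) : μ = ν := by
  have hm : Measurable fun x : ℝ => Real.exp (-x) := by fun_prop
  have hlog : Measurable fun x : ℝ => -Real.log x := Real.measurable_log.neg
  have := Measure.isProbabilityMeasure_map (μ := μ) hm.aemeasurable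
  have := Measure.isProbabilityMeasure_map (μ := ν) hm.aemeasurable
  have hsupp : ∀ τ : Measure ℝ, (∀ᵐ x ∂τ, 0 ≤ x) →
      ∀ᵐ y ∂τ.map fun x => Real.exp (-x), y ∈ Icc (0 : ℝ) 1 := by
    intro τ hτ
    refine (ae_map_iff hm.aemeasurable (p := fun y => y ∈ Icc (0 : ℝ) 1) measurableSet_Icc).2 ?_
    exact hτ.mono fun x hx => ⟨(Real.exp_pos _).le, Real.exp_le_one_iff.2 (by linarith)⟩
  -- Under x ↦ e^(-x) the Laplace transform at integers becomes the moment sequence of a law on [0,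
  -- 1].
  have hmom : ∀ (τ : Measure ℝ) (n : ℕ),
      ∫ y, y ^ n ∂τ.map (fun x => Real.exp (-x)) = ∫ x, Real.exp (-((n : ℝ) * x)) ∂τ := by
    intro τ n
    rw [integral_map hm.aemeasurable (by fun_prop)]
    refine integral_congr_ae (ae_of_all _ fun x => ?_)
    simp only [← Real.exp_nat_mul]
    ring_nf
  have heq : μ.map (fun x => Real.exp (-x)) = ν.map fun x => Real.exp (-x) :=
    Measure.ext_of_integral_pow_eq (hsupp μ hμ) (hsupp ν hν) fun n => by
      rw [hmom, hmom, h n n.cast_nonneg]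
  have hback : ∀ τ : Measure ℝ, (τ.map fun x => Real.exp (-x)).map (fun y => -Real.log y) = τ := by
    intro τ
    rw [Measure.map_map hlog hm]
    convert! Measure.map_id
    ext x
    simp
  rw [← hback μ, heq, hback ν]

end LaplaceUniqueness

/-! ### Stability, submultiplicative tail and mean -/

section PositiveStable

open Set Filter Topology

variable {α : ℝ} {ν : Measure ℝ}

/-- Both Laplace transforms at l equal exp(-(s+t) l^α). -/
lemma IsPositiveStable.map_add [IsProbabilityMeasure ν] (hα0 : 0 < α)
    (hν : IsPositiveStable α (fun z : ℝ => z) ν) {s t : ℝ}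
    (hs : 0 ≤ s) (ht : 0 ≤ t) :
    (ν.prod ν).map (fun p => s ^ (1 / α) * p.1 + t ^ (1 / α) * p.2)
      = ν.map fun z => (s + t) ^ (1 / α) * z := by
  have hpow : ∀ x : ℝ, 0 ≤ x → 0 ≤ x ^ (1 / α) := fun x hx => Real.rpow_nonneg hx _
  have hroot : ∀ x : ℝ, 0 ≤ x → (x ^ (1 / α)) ^ α = x := fun x hx => by
    rw [← Real.rpow_mul hx, one_div_mul_cancel hα0.ne', Real.rpow_one]
  have hm1 : Measurable fun p : ℝ × ℝ => s ^ (1 / α) * p.1 + t ^ (1 / α) * p.2 := by fun_prop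
  have hm2 : Measurable fun z : ℝ => (s + t) ^ (1 / α) * z := by fun_prop
  have := Measure.isProbabilityMeasure_map (μ := ν.prod ν) hm1.aemeasurable
  have := Measure.isProbabilityMeasure_map (μ := ν) hm2.aemeasurable
  refine Measure.ext_of_integral_exp_neg_eq ?_ ?_ fun l hl => ?_
  · rw [ae_map_iff hm1.aemeasurable measurableSet_Ici]
    have h1 : ∀ᵐ p ∂ν.prod ν, 0 < p.1 := Measure.quasiMeasurePreserving_fst.ae hν.pos
    have h2 : ∀ᵐ p ∂ν.prod ν, 0 < p.2 := Measure.quasiMeasurePreserving_snd.ae hν.pos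
    filter_upwards [h1, h2] with p hp1 hp2
    exact add_nonneg (mul_nonneg (hpow s hs) hp1.le) (mul_nonneg (hpow t ht) hp2.le)
  · rw [ae_map_iff hm2.aemeasurable measurableSet_Ici]
    exact hν.pos.mono fun z hz => mul_nonneg (hpow _ (add_nonneg hs ht)) hz.le
  · rw [integral_map hm1.aemeasurable (by fun_prop), integral_map hm2.aemeasurable (by fun_prop)]
    have e1 : ∀ p : ℝ × ℝ, Real.exp (-(l * (s ^ (1 / α) * p.1 + t ^ (1 / α) * p.2)))
        = Real.exp (-(l * s ^ (1 / α) * p.1)) * Real.exp (-(l * t ^ (1 / α) * p.2)) := fun p => by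
      rw [← Real.exp_add]; ring_nf
    have e2 : ∀ z : ℝ, Real.exp (-(l * ((s + t) ^ (1 / α) * z)))
        = Real.exp (-(l * (s + t) ^ (1 / α) * z)) := fun z => by ring_nf
    simp_rw [e1, e2]
    rw [integral_prod_mul (fun x => Real.exp (-(l * s ^ (1 / α) * x)))
      (fun x => Real.exp (-(l * t ^ (1 / α) * x))), hν.laplace _ (mul_nonneg hl (hpow s hs)),
      hν.laplace _ (mul_nonneg hl (hpow t ht)),
      hν.laplace _ (mul_nonneg hl (hpow _ (add_nonneg hs ht))), ← Real.exp_add,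
      Real.mul_rpow hl (hpow s hs), Real.mul_rpow hl (hpow t ht),
      Real.mul_rpow hl (hpow _ (add_nonneg hs ht)), hroot s hs, hroot t ht,
      hroot _ (add_nonneg hs ht)]
    ring_nf

/-- The law of `Z ^ (-α)` when `ν` is the law of `Z`. -/
noncomputable def mittagLefflerLaw (α : ℝ) (ν : Measure ℝ) : Measure ℝ := ν.map fun z => z ^ (-α)

lemma measurable_rpow_neg_const (α : ℝ) : Measurable fun z : ℝ => z ^ (-α) := by fun_prop

instance [IsProbabilityMeasure ν] : IsProbabilityMeasure (mittagLefflerLaw α ν) :=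
  Measure.isProbabilityMeasure_map (measurable_rpow_neg_const α).aemeasurable

/-- The product form x^(1/α) z < 1 also covers x = 0, where the event is certain. -/
lemma IsPositiveStable.mittagLefflerLaw_Ioi (hα0 : 0 < α)
    (hν : IsPositiveStable α (fun z : ℝ => z) ν) {x : ℝ} (hx : 0 ≤ x) :
    mittagLefflerLaw α ν (Ioi x) = ν {z | x ^ (1 / α) * z < 1} := by
  rw [mittagLefflerLaw, Measure.map_apply (measurable_rpow_neg_const α) measurableSet_Ioi]
  refine measure_congr ?_
  filter_upwards [hν.pos] with z hz
  refine propext ?_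
  change x < z ^ (-α) ↔ x ^ (1 / α) * z < 1
  have hw : 0 ≤ x ^ (1 / α) * z := mul_nonneg (Real.rpow_nonneg hx _) hz.le
  rw [Real.rpow_neg hz.le, ← Real.rpow_lt_one_iff' hw hα0,
    Real.mul_rpow (Real.rpow_nonneg hx _) hz.le, ← Real.rpow_mul hx,
    one_div_mul_cancel hα0.ne', Real.rpow_one, ← one_div,
    lt_div_iff₀ (Real.rpow_pos_of_pos hz α)]

/-- If a sum of two positive terms is below 1, so is each term; independence then factors the
probability. -/
lemma IsPositiveStable.mittagLefflerLaw_Ioi_add_le [IsProbabilityMeasure ν] (hα0 : 0 < α)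
    (hν : IsPositiveStable α (fun z : ℝ => z) ν) {s t : ℝ} (hs : 0 ≤ s) (ht : 0 ≤ t) :
    mittagLefflerLaw α ν (Ioi (s + t))
      ≤ mittagLefflerLaw α ν (Ioi s) * mittagLefflerLaw α ν (Ioi t) := by
  rw [hν.mittagLefflerLaw_Ioi hα0 hs, hν.mittagLefflerLaw_Ioi hα0 ht,
    hν.mittagLefflerLaw_Ioi hα0 (add_nonneg hs ht)]
  have h := congrArg (fun τ : Measure ℝ => τ (Iio 1)) (hν.map_add hα0 hs ht)
  rw [Measure.map_apply (by fun_prop) measurableSet_Iio,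
    Measure.map_apply (by fun_prop) measurableSet_Iio] at h
  change _ = ν {z | (s + t) ^ (1 / α) * z < 1} at h
  rw [← h, ← Measure.prod_prod]
  refine measure_mono_ae ?_
  have h1 : ∀ᵐ p ∂ν.prod ν, 0 < p.1 := Measure.quasiMeasurePreserving_fst.ae hν.pos
  have h2 : ∀ᵐ p ∂ν.prod ν, 0 < p.2 := Measure.quasiMeasurePreserving_snd.ae hν.pos
  filter_upwards [h1, h2] with p hp1 hp2
  intro (hp : s ^ (1 / α) * p.1 + t ^ (1 / α) * p.2 < 1)
  have q1 := mul_nonneg (Real.rpow_nonneg hs (1 / α)) hp1.le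
  have q2 := mul_nonneg (Real.rpow_nonneg ht (1 / α)) hp2.le
  exact ⟨show s ^ (1 / α) * p.1 < 1 by linarith, show t ^ (1 / α) * p.2 < 1 by linarith⟩

/-- Write z^(-α) as Γ(α)⁻¹ ∫ t^(α-1) e^(-tz) dt and apply Tonelli; the mean is Γ(α)⁻¹ ∫ t^(α-1)
exp(-t^α) dt = 1/(α Γ(α)). -/
lemma IsPositiveStable.lintegral_mittagLefflerLaw [IsProbabilityMeasure ν] (hα0 : 0 < α)
    (hν : IsPositiveStable α (fun z : ℝ => z) ν) :
    ∫⁻ x, ENNReal.ofReal x ∂mittagLefflerLaw α ν = ENNReal.ofReal (Real.Gamma (1 + α))⁻¹ := by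
  have hΓ : 0 < Real.Gamma α := Real.Gamma_pos_of_pos hα0
  rw [mittagLefflerLaw, lintegral_map ENNReal.measurable_ofReal (measurable_rpow_neg_const α)]
  have hinner : ∀ᵐ z ∂ν, ENNReal.ofReal (z ^ (-α)) = ENNReal.ofReal (Real.Gamma α)⁻¹
      * ∫⁻ t in Ioi (0 : ℝ),
        ENNReal.ofReal (t ^ (α - 1)) * ENNReal.ofReal (Real.exp (-(t * z))) := by
    filter_upwards [hν.pos] with z hz
    have hint : IntegrableOn (fun t : ℝ => t ^ (α - 1) * Real.exp (-(z * t))) (Ioi 0) := by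
      have := integrableOn_rpow_mul_exp_neg_mul_rpow (p := 1) (s := α - 1) (b := z) (by linarith)
        one_pos hz
      simpa using this
    have hval := Real.integral_rpow_mul_exp_neg_mul_Ioi hα0 hz
    have e : ∫⁻ t in Ioi (0 : ℝ),
        ENNReal.ofReal (t ^ (α - 1)) * ENNReal.ofReal (Real.exp (-(t * z)))
        = ENNReal.ofReal (∫ t in Ioi (0 : ℝ), t ^ (α - 1) * Real.exp (-(z * t))) := by
      rw [ofReal_integral_eq_lintegral_ofReal hint ((ae_restrict_iff' measurableSet_Ioi).2
        (ae_of_all _ fun t ht => mul_nonneg (Real.rpow_nonneg (le_of_lt ht) _)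
          (Real.exp_pos _).le))]
      refine setLIntegral_congr_fun measurableSet_Ioi fun t ht => ?_
      simp only [mul_comm t z]
      rw [← ENNReal.ofReal_mul (Real.rpow_nonneg (le_of_lt ht) _)]
    rw [e, hval, ← ENNReal.ofReal_mul (inv_nonneg.2 hΓ.le)]
    congr 1
    rw [one_div, Real.inv_rpow hz.le, Real.rpow_neg hz.le]
    field_simp
  rw [lintegral_congr_ae hinner, lintegral_const_mul _ (by fun_prop), lintegral_lintegral_swap
    (by fun_prop)]
  have hlap : ∀ t ∈ Ioi (0 : ℝ), ∫⁻ z, ENNReal.ofReal (t ^ (α - 1))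
      * ENNReal.ofReal (Real.exp (-(t * z))) ∂ν
      = ENNReal.ofReal (t ^ (α - 1) * Real.exp (-t ^ α)) := by
    intro t ht
    have hint : Integrable (fun z => Real.exp (-(t * z))) ν :=
      Integrable.of_bound (by fun_prop) 1 (hν.pos.mono fun z hz => by
        rw [Real.norm_eq_abs, Real.abs_exp]
        exact Real.exp_le_one_iff.2 (by have := mul_pos (show 0 < t from ht) hz; linarith))
    rw [lintegral_const_mul _ (by fun_prop), ← ofReal_integral_eq_lintegral_ofReal hint
      (ae_of_all _ fun z => (Real.exp_pos _).le), hν.laplace t (le_of_lt ht),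
      ← ENNReal.ofReal_mul (Real.rpow_nonneg (le_of_lt ht) _)]
  rw [setLIntegral_congr_fun measurableSet_Ioi hlap, ← ofReal_integral_eq_lintegral_ofReal
    (integrableOn_rpow_mul_exp_neg_rpow (by linarith) hα0)
    ((ae_restrict_iff' measurableSet_Ioi).2 (ae_of_all _ fun t ht =>
      mul_nonneg (Real.rpow_nonneg (le_of_lt ht) _) (Real.exp_pos _).le)),
    integral_rpow_mul_exp_neg_rpow hα0 (by linarith), ← ENNReal.ofReal_mul (inv_nonneg.2 hΓ.le)]
  congr 1
  rw [sub_add_cancel, div_self hα0.ne', Real.Gamma_one, add_comm 1 α, Real.Gamma_add_one hα0.ne']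
  field_simp

end PositiveStable

/-! ### Slope of the distribution function at the origin -/

section MittagLeffler

open Set Filter Topology

variable {α : ℝ} {ν : Measure ℝ} [IsProbabilityMeasure ν]

/-- With l = s^(1/α), M ≤ s u^(-α) means u ≤ l Z, so the average over u is E[1 - e^(-lZ)]. -/
lemma IsPositiveStable.integral_mittagLefflerLaw_Iic (hα0 : 0 < α)
    (hν : IsPositiveStable α (fun z : ℝ => z) ν) {s : ℝ} (hs : 0 < s) :
    IntegrableOn (fun u => Real.exp (-u) * (mittagLefflerLaw α ν).real (Iic (s * u ^ (-α))))
        (Ioi 0) ∧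
      ∫ u in Ioi (0 : ℝ), Real.exp (-u) * (mittagLefflerLaw α ν).real (Iic (s * u ^ (-α)))
        = 1 - Real.exp (-s) := by
  set l : ℝ := s ^ (1 / α) with hl
  have hl0 : 0 < l := Real.rpow_pos_of_pos hs _
  have hls : l ^ α = s := by
    rw [hl, ← Real.rpow_mul hs.le, one_div_mul_cancel hα0.ne', Real.rpow_one]
  have hIic : ∀ u ∈ Ioi (0 : ℝ),
      mittagLefflerLaw α ν (Iic (s * u ^ (-α))) = ν {z | u ≤ l * z} := by
    intro u (hu : 0 < u)
    have hy : 0 ≤ s * u ^ (-α) := mul_nonneg hs.le (Real.rpow_nonneg hu.le _)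
    have hroot : (s * u ^ (-α)) ^ (1 / α) = l / u := by
      rw [Real.mul_rpow hs.le (Real.rpow_nonneg hu.le _), ← Real.rpow_mul hu.le,
        neg_mul, mul_one_div_cancel hα0.ne', Real.rpow_neg_one]
      rfl
    have hset : {z : ℝ | u ≤ l * z} = {z | (s * u ^ (-α)) ^ (1 / α) * z < 1}ᶜ := by
      ext z
      rw [hroot]
      simp only [mem_ofPred_eq, mem_compl_iff, not_lt]
      rw [div_mul_eq_mul_div, one_le_div hu]
    rw [hset, prob_compl_eq_one_sub (measurableSet_lt (by fun_prop) measurable_const),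
      ← hν.mittagLefflerLaw_Ioi hα0 hy, ← compl_Ioi, prob_compl_eq_one_sub measurableSet_Ioi]
  have hmeas : Measurable fun u : ℝ =>
      Real.exp (-u) * (mittagLefflerLaw α ν).real (Iic (s * u ^ (-α))) := by
    have hF : Measurable fun y => (mittagLefflerLaw α ν).real (Iic y) :=
      Monotone.measurable fun a b h => measureReal_mono (Iic_subset_Iic.2 h)
    have hpow : Measurable fun u : ℝ => s * u ^ (-α) := by fun_prop
    exact (by fun_prop : Measurable fun u : ℝ => Real.exp (-u)).mul (hF.comp hpow)
  have hnn : ∀ u : ℝ, 0 ≤ Real.exp (-u) * (mittagLefflerLaw α ν).real (Iic (s * u ^ (-α))) :=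
    fun u => mul_nonneg (Real.exp_pos _).le measureReal_nonneg
  have hexp : Integrable (fun z => Real.exp (-(l * z))) ν :=
    Integrable.of_bound (by fun_prop) 1 (hν.pos.mono fun z hz => by
      rw [Real.norm_eq_abs, Real.abs_exp]
      exact Real.exp_le_one_iff.2 (by have := mul_pos hl0 hz; linarith))
  have hlint : ∫⁻ u in Ioi (0 : ℝ), ENNReal.ofReal
      (Real.exp (-u) * (mittagLefflerLaw α ν).real (Iic (s * u ^ (-α))))
      = ENNReal.ofReal (1 - Real.exp (-s)) := by
    have hprim : ∀ x : ℝ, ∫ t in (0 : ℝ)..x, Real.exp (-t) = 1 - Real.exp (-x) := fun x => by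
      simp
    have hcake := lintegral_comp_eq_lintegral_meas_le_mul (f := fun z => l * z)
      (g := fun t => Real.exp (-t)) ν (hν.pos.mono fun z hz => (mul_pos hl0 hz).le)
      (by fun_prop)
      (fun t _ => (by fun_prop : Continuous fun t : ℝ => Real.exp (-t)).intervalIntegrable _ _)
      (ae_of_all _ fun t => (Real.exp_pos _).le)
    simp_rw [hprim] at hcake
    rw [← ofReal_integral_eq_lintegral_ofReal (f := fun z => 1 - Real.exp (-(l * z)))
      ((integrable_const 1).sub hexp)
      (hν.pos.mono fun z hz => sub_nonneg.2 (Real.exp_le_one_iff.2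
        (by have := mul_pos hl0 hz; linarith))), integral_sub (integrable_const 1) hexp,
      hν.laplace l hl0.le, hls] at hcake
    simp only [integral_const, probReal_univ, smul_eq_mul, mul_one] at hcake
    rw [hcake]
    refine setLIntegral_congr_fun measurableSet_Ioi fun u hu => ?_
    rw [ENNReal.ofReal_mul (Real.exp_pos _).le, ofReal_measureReal, hIic u hu, mul_comm]
  constructor
  · refine ⟨hmeas.aestronglyMeasurable, ?_⟩
    rw [hasFiniteIntegral_iff_ofReal (ae_of_all _ hnn), hlint]
    exact ENNReal.ofReal_lt_top
  · rw [integral_eq_lintegral_of_nonneg_ae (ae_of_all _ hnn) hmeas.aestronglyMeasurable, hlint,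
      ENNReal.toReal_ofReal (sub_nonneg.2 (Real.exp_le_one_iff.2 (by linarith)))]

/-- The same average for a trial bound of F; αp < 1 keeps u^(-αp) integrable at 0. -/
lemma integral_exp_neg_mul_power_sum {α p : ℝ} (hα1 : α < 1) (hp : α * p < 1) (a b : ℝ) {s : ℝ}
    (hs : 0 < s) :
    IntegrableOn (fun u : ℝ => Real.exp (-u) * (a * (s * u ^ (-α)) + b * (s * u ^ (-α)) ^ p))
        (Ioi 0) ∧
      ∫ u in Ioi (0 : ℝ), Real.exp (-u) * (a * (s * u ^ (-α)) + b * (s * u ^ (-α)) ^ p)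
        = a * Real.Gamma (1 - α) * s + b * Real.Gamma (1 - α * p) * s ^ p := by
  have e : ∀ u ∈ Ioi (0 : ℝ), a * s * (Real.exp (-u) * u ^ ((1 - α) - 1))
      + b * s ^ p * (Real.exp (-u) * u ^ ((1 - α * p) - 1))
      = Real.exp (-u) * (a * (s * u ^ (-α)) + b * (s * u ^ (-α)) ^ p) := by
    intro u (hu : 0 < u)
    rw [Real.mul_rpow hs.le (Real.rpow_nonneg hu.le _), ← Real.rpow_mul hu.le,
      show (1 - α) - 1 = -α by ring, show (1 - α * p) - 1 = -α * p by ring]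
    ring
  have h1 := (Real.GammaIntegral_convergent (s := 1 - α) (by linarith)).const_mul (a * s)
  have h2 := (Real.GammaIntegral_convergent (s := 1 - α * p) (by linarith)).const_mul (b * s ^ p)
  constructor
  · exact IntegrableOn.congr_fun (h1.add h2) e measurableSet_Ioi
  · rw [← setIntegral_congr_fun measurableSet_Ioi e, integral_add h1 h2, integral_const_mul,
      integral_const_mul, ← Real.Gamma_eq_integral (by linarith),
      ← Real.Gamma_eq_integral (by linarith)]
    ring

lemma tendsto_one_sub_exp_neg_div :
    Tendsto (fun s : ℝ => (1 - Real.exp (-s)) / s) (𝓝[>] 0) (𝓝 1) := by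
  have h : HasDerivAt (fun s : ℝ => 1 - Real.exp (-s)) 1 0 := by
    have := ((hasDerivAt_neg (0 : ℝ)).exp).const_sub 1
    simpa using this
  have h' := (hasDerivAt_iff_tendsto_slope_zero.1 h).mono_left
    (nhdsWithin_mono (0 : ℝ) (fun x (hx : 0 < x) => hx.ne'))
  refine h'.congr fun s => ?_
  simp
  ring

lemma tendsto_add_mul_rpow_div (A B : ℝ) {p : ℝ} (hp : 1 < p) :
    Tendsto (fun s : ℝ => (A * s + B * s ^ p) / s) (𝓝[>] 0) (𝓝 A) := by
  have h : Tendsto (fun s : ℝ => A + B * s ^ (p - 1)) (𝓝[>] 0) (𝓝 (A + B * 0)) := by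
    refine tendsto_const_nhds.add (Tendsto.const_mul B ?_)
    have := (Real.continuousAt_rpow_const 0 (p - 1) (Or.inr (by linarith))).tendsto
    rw [Real.zero_rpow (by linarith)] at this
    exact this.mono_left nhdsWithin_le_nhds
  rw [mul_zero, add_zero] at h
  refine h.congr' ?_
  filter_upwards [self_mem_nhdsWithin] with s (hs : 0 < s)
  rw [Real.rpow_sub_one hs.ne']
  field_simp

/-- Average the bound, divide by s and let s → 0: since p > 1, only the linear coefficient survives.
This replaces a Tauberian theorem. -/
lemma IsPositiveStable.one_le_of_mittagLefflerLaw_Iic_le (hα0 : 0 < α) (hα1 : α < 1)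
    (hν : IsPositiveStable α (fun z : ℝ => z) ν) {p a b : ℝ} (hp : 1 < p) (hp' : α * p < 1)
    (h : ∀ y, 0 < y → (mittagLefflerLaw α ν).real (Iic y) ≤ a * y + b * y ^ p) :
    1 ≤ a * Real.Gamma (1 - α) := by
  refine le_of_tendsto_of_tendsto tendsto_one_sub_exp_neg_div
    (tendsto_add_mul_rpow_div _ (b * Real.Gamma (1 - α * p)) hp) ?_
  filter_upwards [self_mem_nhdsWithin] with s (hs : 0 < s)
  obtain ⟨i1, e1⟩ := hν.integral_mittagLefflerLaw_Iic hα0 hs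
  obtain ⟨i2, e2⟩ := integral_exp_neg_mul_power_sum hα1 hp' a b hs
  rw [← e1, ← e2]
  refine div_le_div_of_nonneg_right (setIntegral_mono_on i1 i2 measurableSet_Ioi ?_) hs.le
  intro u (hu : 0 < u)
  exact mul_le_mul_of_nonneg_left (h _ (mul_pos hs (Real.rpow_pos_of_pos hu _))) (Real.exp_pos _).le

lemma IsPositiveStable.le_one_of_le_mittagLefflerLaw_Iic (hα0 : 0 < α) (hα1 : α < 1)
    (hν : IsPositiveStable α (fun z : ℝ => z) ν) {p a b : ℝ} (hp : 1 < p) (hp' : α * p < 1)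
    (h : ∀ y, 0 < y → a * y + b * y ^ p ≤ (mittagLefflerLaw α ν).real (Iic y)) :
    a * Real.Gamma (1 - α) ≤ 1 := by
  refine le_of_tendsto_of_tendsto (tendsto_add_mul_rpow_div _ (b * Real.Gamma (1 - α * p)) hp)
    tendsto_one_sub_exp_neg_div ?_
  filter_upwards [self_mem_nhdsWithin] with s (hs : 0 < s)
  obtain ⟨i1, e1⟩ := hν.integral_mittagLefflerLaw_Iic hα0 hs
  obtain ⟨i2, e2⟩ := integral_exp_neg_mul_power_sum hα1 hp' a b hs
  rw [← e1, ← e2]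
  refine div_le_div_of_nonneg_right (setIntegral_mono_on i2 i1 measurableSet_Ioi ?_) hs.le
  intro u (hu : 0 < u)
  exact mul_le_mul_of_nonneg_left (h _ (mul_pos hs (Real.rpow_pos_of_pos hu _))) (Real.exp_pos _).le

lemma measureReal_Iic_eq (μ : Measure ℝ) [IsProbabilityMeasure μ] (y : ℝ) :
    μ.real (Iic y) = 1 - μ.real (Ioi y) := by
  rw [← compl_Ioi, probReal_compl_eq_one_sub measurableSet_Ioi]

/-- A tail `μ (Ioi x₀) > exp (-θ x₀)` of a law that is new better than used bounds its
distribution function near the origin. -/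
lemma measureReal_Iic_le_of_newBetterThanUsed {μ : Measure ℝ} [IsProbabilityMeasure μ]
    (hnbu : ∀ s t, 0 ≤ s → 0 ≤ t → μ.real (Ioi (s + t)) ≤ μ.real (Ioi s) * μ.real (Ioi t))
    {x₀ θ : ℝ} (hx₀ : 0 < x₀) (hθ : 0 ≤ θ) (h : Real.exp (-(θ * x₀)) < μ.real (Ioi x₀))
    {y : ℝ} (hy : 0 < y) (hyx : y < x₀) : μ.real (Iic y) ≤ θ * x₀ / (x₀ - y) * y := by
  have hpow : ∀ n : ℕ, μ.real (Ioi ((n + 1 : ℕ) * y)) ≤ μ.real (Ioi y) ^ (n + 1) := by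
    intro n
    induction n with
    | zero => simp
    | succ k ih =>
      have := hnbu ((k + 1 : ℕ) * y) y (by positivity) hy.le
      rw [pow_succ]
      calc μ.real (Ioi ((k + 1 + 1 : ℕ) * y)) = μ.real (Ioi ((k + 1 : ℕ) * y + y)) := by
            congr 2; push_cast; ring
        _ ≤ _ := this
        _ ≤ _ := mul_le_mul_of_nonneg_right ih measureReal_nonneg
  -- N y ≤ x₀ gives μ(Ioi x₀) ≤ μ(Ioi y)^N, and N y > x₀ - y bounds 1/N from above.
  set N := ⌊x₀ / y⌋₊ with hN
  have hN1 : (N : ℝ) * y ≤ x₀ := by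
    have := Nat.floor_le (div_pos hx₀ hy).le
    rwa [← hN, le_div_iff₀ hy] at this
  have hN2 : x₀ - y < N * y := by
    have := Nat.lt_floor_add_one (x₀ / y)
    rw [← hN, div_lt_iff₀ hy] at this
    linarith
  have hN0 : 0 < (N : ℝ) := by
    by_contra hc
    have : (N : ℝ) * y ≤ 0 := mul_nonpos_of_nonpos_of_nonneg (not_lt.1 hc) hy.le
    linarith
  obtain ⟨n, hn⟩ : ∃ n, N = n + 1 := Nat.exists_eq_succ_of_ne_zero (by
    rintro h0; simp [h0] at hN0)
  have hlt : Real.exp (-(θ * x₀ / N)) ^ N < μ.real (Ioi y) ^ N := by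
    rw [← Real.exp_nat_mul, show (N : ℝ) * -(θ * x₀ / N) = -(θ * x₀) by field_simp]
    refine h.trans_le ((measureReal_mono (Ioi_subset_Ioi hN1)).trans ?_)
    have := hpow n
    rwa [← hn] at this
  have hlt' := lt_of_pow_lt_pow_left₀ N measureReal_nonneg hlt
  have hexp := Real.add_one_le_exp (-(θ * x₀ / N))
  rw [measureReal_Iic_eq]
  have hbound : θ * x₀ / N ≤ θ * x₀ / (x₀ - y) * y := by
    rw [div_mul_eq_mul_div, div_le_div_iff₀ hN0 (by linarith)]
    have := mul_nonneg hθ hx₀.le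
    nlinarith
  linarith

lemma IsPositiveStable.mittagLefflerLaw_Ioi_le (hα0 : 0 < α) (hα1 : α < 1)
    (hν : IsPositiveStable α (fun z : ℝ => z) ν) {x : ℝ} (hx : 0 ≤ x) :
    (mittagLefflerLaw α ν).real (Ioi x) ≤ Real.exp (-(x / Real.Gamma (1 - α))) := by
  have hΓ : 0 < Real.Gamma (1 - α) := Real.Gamma_pos_of_pos (by linarith)
  rcases hx.eq_or_lt with rfl | hx
  · simp
  by_contra! hcon
  obtain ⟨θ, hθ0, hθ1, hθ⟩ : ∃ θ, 0 < θ ∧ θ < 1 / Real.Gamma (1 - α) ∧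
      Real.exp (-(θ * x)) < (mittagLefflerLaw α ν).real (Ioi x) := by
    -- The assumed inequality is strict, so by continuity it survives a slightly smaller rate θ.
    have hc : Tendsto (fun θ : ℝ => Real.exp (-(θ * x))) (𝓝[<] (1 / Real.Gamma (1 - α)))
        (𝓝 (Real.exp (-(1 / Real.Gamma (1 - α) * x)))) :=
      (by fun_prop : Continuous fun θ : ℝ => Real.exp (-(θ * x))).continuousAt.tendsto.mono_left
        nhdsWithin_le_nhds
    rw [one_div_mul_eq_div] at hc
    have h1 := hc.eventually_lt_const hcon
    have h2 : ∀ᶠ θ : ℝ in 𝓝[<] (1 / Real.Gamma (1 - α)), 0 < θ :=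
      (lt_mem_nhds (by positivity)).filter_mono nhdsWithin_le_nhds
    obtain ⟨θ, ⟨h1, h2⟩, h3⟩ := ((h1.and h2).and self_mem_nhdsWithin).exists
    exact ⟨θ, h2, h3, h1⟩
  obtain ⟨θ', hθ', hθ'1⟩ := exists_between hθ1
  obtain ⟨p, hp, hp'⟩ := exists_between ((one_lt_div hα0).2 hα1)
  have hαp : α * p < 1 := by rwa [lt_div_iff₀ hα0, mul_comm] at hp'
  have hθ'0 : 0 < θ' := hθ0.trans hθ'
  -- Chosen so that θx/(x - δ) = θ'. Below δ the linear term bounds F; from δ on, (y/δ)^p ≥ 1 does.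
  set δ : ℝ := x * (1 - θ / θ') with hδ
  have hfrac : θ / θ' < 1 := (div_lt_one hθ'0).2 hθ'
  have hδ0 : 0 < δ := mul_pos hx (by linarith)
  have hnbu : ∀ s t, 0 ≤ s → 0 ≤ t → (mittagLefflerLaw α ν).real (Ioi (s + t))
      ≤ (mittagLefflerLaw α ν).real (Ioi s) * (mittagLefflerLaw α ν).real (Ioi t) := by
    intro s t hs ht
    have := hν.mittagLefflerLaw_Ioi_add_le hα0 hs ht
    rw [measureReal_def, measureReal_def, measureReal_def, ← ENNReal.toReal_mul]
    exact ENNReal.toReal_mono (ENNReal.mul_ne_top (measure_ne_top _ _) (measure_ne_top _ _)) this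
  have hF : ∀ y, 0 < y → (mittagLefflerLaw α ν).real (Iic y) ≤ θ' * y + δ⁻¹ ^ p * y ^ p := by
    intro y hy
    have hc0 : 0 ≤ δ⁻¹ ^ p * y ^ p := by positivity
    rcases lt_or_ge y δ with hyδ | hyδ
    · have hθδ : θ' * (x - δ) = θ * x := by rw [hδ]; field_simp; ring
      have hδx : δ < x := by
        have : 0 < θ' * (x - δ) := by rw [hθδ]; positivity
        linarith [pos_of_mul_pos_right this hθ'0.le]
      have hyx : y < x := hyδ.trans hδx
      have h1 := measureReal_Iic_le_of_newBetterThanUsed hnbu hx hθ0.le hθ hy hyx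
      have h2 : θ * x / (x - y) ≤ θ' := by
        rw [div_le_iff₀ (by linarith), ← hθδ]
        gcongr
      have h3 := mul_le_mul_of_nonneg_right h2 hy.le
      linarith
    · have h1 : 1 ≤ δ⁻¹ ^ p * y ^ p := by
        rw [← Real.mul_rpow (by positivity) hy.le]
        refine Real.one_le_rpow ?_ (by linarith)
        rwa [inv_mul_eq_div, one_le_div hδ0]
      have h2 : (mittagLefflerLaw α ν).real (Iic y) ≤ 1 := measureReal_le_one
      have : 0 < θ' * y := by positivity
      linarith
  have := hν.one_le_of_mittagLefflerLaw_Iic_le hα0 hα1 hp hαp hF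
  rw [lt_div_iff₀ hΓ] at hθ'1
  linarith

/-- For x ≤ 1 the quadratic Taylor bound suffices, as p ≤ 2; for x ≥ 1 the left side is nonpositive.
-/
lemma sub_rpow_le_one_sub_exp_neg {x p : ℝ} (hx : 0 < x) (hp1 : 1 < p) (hp2 : p ≤ 2) :
    x - x ^ p ≤ 1 - Real.exp (-x) := by
  rcases le_total x 1 with h | h
  · have h1 : x ^ (2 : ℝ) ≤ x ^ p := Real.rpow_le_rpow_of_exponent_ge hx h hp2
    rw [Real.rpow_two] at h1
    have h2 := Real.abs_exp_sub_one_sub_id_le (x := -x) (by rwa [abs_neg, abs_of_pos hx])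
    have h3 := (abs_le.1 h2).2
    rw [neg_sq] at h3
    linarith
  · have h1 : x ≤ x ^ p := Real.self_le_rpow_of_one_le h hp1.le
    have h2 : Real.exp (-x) ≤ 1 := Real.exp_le_one_iff.2 (by linarith)
    linarith

lemma IsPositiveStable.mul_Gamma_le_one_of_mittagLefflerLaw_Ioi_le (hα0 : 0 < α) (hα1 : α < 1)
    (hν : IsPositiveStable α (fun z : ℝ => z) ν) {θ : ℝ} (hθ : 0 < θ)
    (h : ∀ y, 0 < y → (mittagLefflerLaw α ν).real (Ioi y) ≤ Real.exp (-(θ * y))) :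
    θ * Real.Gamma (1 - α) ≤ 1 := by
  obtain ⟨p, hp, hp'⟩ := exists_between
    (lt_min ((one_lt_div hα0).2 hα1) (one_lt_two : (1 : ℝ) < 2))
  have hpα := hp'.trans_le (min_le_left _ _)
  have hαp : α * p < 1 := by rwa [lt_div_iff₀ hα0, mul_comm] at hpα
  refine hν.le_one_of_le_mittagLefflerLaw_Iic hα0 hα1 (b := -θ ^ p) hp hαp fun y hy => ?_
  rw [measureReal_Iic_eq]
  have h1 := sub_rpow_le_one_sub_exp_neg (mul_pos hθ hy) hp (hp'.le.trans (min_le_right _ _))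
  rw [Real.mul_rpow hθ.le hy.le] at h1
  have := h y hy
  linarith

end MittagLeffler

/-! ### Scaling and the main theorem -/

lemma map_mul_Ioi {Ω : Type*} [MeasurableSpace Ω] {P : Measure Ω} {X : Ω → ℝ}
    (hX : AEMeasurable X P) {c : ℝ} (hc : 0 < c) (a : ℝ) :
    P.map (fun ω => c * X ω) (Set.Ioi a) = P.map X (Set.Ioi (a / c)) := by
  have hm : Measurable fun x : ℝ => c * x := by fun_prop
  have h := AEMeasurable.map_map_of_aemeasurable hm.aemeasurable hX
  change _ = P.map (fun ω => c * X ω) at h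
  rw [← h, Measure.map_apply hm measurableSet_Ioi]
  congr 1
  ext x
  simp [div_lt_iff₀' hc]

theorem theoremC {Ω Ω' : Type*} [MeasurableSpace Ω] [MeasurableSpace Ω']
    (P : Measure Ω) [IsProbabilityMeasure P] (P' : Measure Ω') [IsProbabilityMeasure P']
    (α : ℝ) (hα0 : 0 < α) (hα1 : α < 1)
    (M : Ω → ℝ) (hM : IsMittagLeffler α M P)
    (L : Ω' → ℝ) (hL : HasLaw L (expMeasure 1) P') :
    OptStochLE M P (fun ω => Real.Gamma (1 - α) * L ω) P' ∧
      ConvexLE (fun ω => Real.Gamma (1 + α) * M ω) P L P' := by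
  obtain ⟨ν, _, hν, hid⟩ := hM
  have hMm : AEMeasurable M P := hid.aemeasurable_fst
  have hlaw : P.map M = mittagLefflerLaw α ν := hid.map_eq
  have hΓ : 0 < Real.Gamma (1 - α) := Real.Gamma_pos_of_pos (by linarith)
  have hΓ' : 0 < Real.Gamma (1 + α) := Real.Gamma_pos_of_pos (by linarith)
  have hLm : AEMeasurable (fun ω => Real.Gamma (1 - α) * L ω) P' := hL.aemeasurable.const_mul _
  have := isProbabilityMeasure_expMeasure (r := 1) one_pos
  have hLtail : ∀ a, 0 ≤ a → P'.map (fun ω => Real.Gamma (1 - α) * L ω) (Set.Ioi a)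
      = ENNReal.ofReal (Real.exp (-(a / Real.Gamma (1 - α)))) := fun a ha => by
    rw [map_mul_Ioi hL.aemeasurable hΓ, hL.map_eq, expMeasure_Ioi (by positivity)]
  refine ⟨⟨stochLE_of_map_Ioi_le hMm hLm fun a => ?_, ?_⟩, ?_⟩
  · rcases le_total 0 a with ha | ha
    · rw [hLtail a ha, hlaw, ← ofReal_measureReal]
      exact ENNReal.ofReal_le_ofReal (hν.mittagLefflerLaw_Ioi_le hα0 hα1 ha)
    · have h0 := hLtail 0 le_rfl
      simp only [zero_div, neg_zero, Real.exp_zero, ENNReal.ofReal_one] at h0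
      rw [hlaw]
      exact prob_le_one.trans (h0 ▸ measure_mono (Set.Ioi_subset_Ioi ha))
  · rintro ⟨c, hc, hst⟩
    have hc0 : 0 < c := by linarith
    -- The order at level c y reads S(y) ≤ exp(-c y/Γ(1-α)), which forces c ≤ 1.
    have key := hν.mul_Gamma_le_one_of_mittagLefflerLaw_Ioi_le hα0 hα1
      (θ := c / Real.Gamma (1 - α)) (by positivity) fun y hy => by
        have h := hst.map_Ioi_le (hMm.const_mul c) hLm (c * y)
        rw [map_mul_Ioi hMm hc0, hLtail _ (by positivity), hlaw, mul_div_cancel_left₀ _ hc0.ne',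
          ← ofReal_measureReal, ENNReal.ofReal_le_ofReal_iff (Real.exp_pos _).le] at h
        rwa [div_mul_eq_mul_div]
    rw [div_mul_cancel₀ _ hΓ.ne'] at key
    linarith
  · have hcm : Measurable fun x : ℝ => Real.Gamma (1 + α) * x := by fun_prop
    have hmap : P.map (fun ω => Real.Gamma (1 + α) * M ω)
        = (mittagLefflerLaw α ν).map fun x => Real.Gamma (1 + α) * x := by
      rw [← hlaw]
      exact (AEMeasurable.map_map_of_aemeasurable hcm.aemeasurable hMm).symm
    refine convexLE_exp_of_newBetterThanUsed (hMm.const_mul _) hL ?_ ?_ fun s t hs ht => ?_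
    · rw [hmap, ae_map_iff hcm.aemeasurable measurableSet_Ici, mittagLefflerLaw,
        ae_map_iff (measurable_rpow_neg_const α).aemeasurable (measurableSet_le (by fun_prop)
          (by fun_prop))]
      exact hν.pos.mono fun z hz => mul_nonneg hΓ'.le (Real.rpow_nonneg hz.le _)
    · rw [hmap, lintegral_map ENNReal.measurable_ofReal hcm]
      simp_rw [ENNReal.ofReal_mul hΓ'.le]
      rw [lintegral_const_mul _ ENNReal.measurable_ofReal, hν.lintegral_mittagLefflerLaw hα0,
        ← ENNReal.ofReal_mul hΓ'.le, mul_inv_cancel₀ hΓ'.ne', ENNReal.ofReal_one]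
    · rw [map_mul_Ioi hMm hΓ', map_mul_Ioi hMm hΓ', map_mul_Ioi hMm hΓ', hlaw, add_div]
      exact hν.mittagLefflerLaw_Ioi_add_le hα0 (by positivity) (by positivity)
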